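/- All groups are finite. For a group $G$ with identity $e$, the power graph $\mathcal P_G$ is the simple graph with vertex set $G$ in which two distinct elements are adjacent if one of them is a power of the other; $d$ denotes its graph distance. A resolving set is a set $S\subseteq G$ such that any $u,v\in G$ with $d(u,s)=d(v,s)$ for all $s\in S$ are equal, and the metric dimension $\dim(\mathcal P_G)$ is the minimum cardinality of a resolving set. For $x\in G$ let $N(x)$ be the set of neighbours of $x$ in $\mathcal P_G$ and $N[x]=N(x)\cup\{x\}$. Write $x\equiv y$ if $N(x)=N(y)$ or $N[x]=N[y]$; this is an equivalence relation. Let $\overline{x}$ be the class of $x$ and $\mathcal U(G)=\{\overline{x} : x\in G\}$. For $x,y\in G$ put $R\{x,y\}=\{z\in G : d(x,z)\neq d(y,z)\}$. A resolving involution of $G$ is an element $w$ of order $2$ for which there are $x,y\in G\setminus\overline{w}$ with $R\{x,y\}=\{x,y,w\}$; let $W(G)$ be the set of resolving involutions of $G$. Let $\Psi$ be the class of noncyclic groups $G$ for which there is an odd prime $p$ such that (C1) the prime divisors of $|G|$ are exactly $2$ and $p$; (C2) $G$ has a unique subgroup of order $p$; (C3) $G$ has no element of order $4$; (C4) each involution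 of $G$ is contained in a cyclic subgroup of order $2p$. Theorem. Let $G$ be a finite group. (i) If $G\in\Psi$, then $\dim(\mathcal P_G)=|G|-|\mathcal U(G)|+1$. (ii) If $G\notin\Psi$, then $\dim(\mathcal P_G)=|G|-|\mathcal U(G)|+|W(G)|$. -/

import Mathlib

namespace PowerGraph

/-- A set `S` of vertices of `Γ` is resolving if the distances to the members of `S`
determine every vertex. -/
def IsResolvingSet {V : Type*} (Γ : SimpleGraph V) (S : Set V) : Prop :=
  ∀ u v : V, (∀ s ∈ S, Γ.dist u s = Γ.dist v s) → u = v

/-- The metric dimension: the minimum cardinality of a resolving set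
(used for finite connected graphs). -/
noncomputable def metricDim {V : Type*} (Γ : SimpleGraph V) : ℕ :=
  sInf {n : ℕ | ∃ S : Set V, IsResolvingSet Γ S ∧ S.ncard = n}

/-- The power graph of `G`: two distinct elements are adjacent if one is a power of the other. -/
def powerGraph (G : Type*) [Group G] : SimpleGraph G where
  Adj x y := x ≠ y ∧ ((∃ m : ℕ, y = x ^ m) ∨ (∃ m : ℕ, x = y ^ m))
  symm := ⟨fun _ _ h => ⟨h.1.symm, h.2.symm⟩⟩
  loopless := ⟨fun _ h => h.1 rfl⟩

/-- The power graph is connected, since the identity is adjacent to every other vertex;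
so `SimpleGraph.dist` is the genuine distance on it. -/
theorem powerGraph_connected (G : Type*) [Group G] : (powerGraph G).Connected := by
  have h : ∀ x : G, (powerGraph G).Reachable x 1 := by
    intro x
    by_cases hx : x = 1
    · subst hx
      exact SimpleGraph.Reachable.refl _
    · have hadj : (powerGraph G).Adj x 1 := ⟨hx, Or.inl ⟨0, (pow_zero x).symm⟩⟩
      exact hadj.reachable
  exact ⟨fun x y => (h x).trans (h y).symm⟩

/-- The closed neighbourhood `N[x]` of `x` in the power graph. -/
def closedNbhd {G : Type*} [Group G] (x : G) : Set G :=
  insert x ((powerGraph G).neighborSet x)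

/-- The twin relation: `N(x) = N(y)` or `N[x] = N[y]`. -/
def Twin {G : Type*} [Group G] (x y : G) : Prop :=
  (powerGraph G).neighborSet x = (powerGraph G).neighborSet y ∨ closedNbhd x = closedNbhd y

/-- The class of `x` under the twin relation. -/
def twinClass {G : Type*} [Group G] (x : G) : Set G :=
  {y : G | Twin x y}

/-- The set `U(G)` of all twin classes. -/
def twinClasses (G : Type*) [Group G] : Set (Set G) :=
  {C : Set G | ∃ x : G, C = twinClass x}

/-- The set `R{x, y}` of the elements that have different distances to `x` and `y`. -/
def resolvers {G : Type*} [Group G] (x y : G) : Set G :=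
  {z : G | (powerGraph G).dist x z ≠ (powerGraph G).dist y z}

/-- The set `W(G)` of all resolving involutions: the involutions `w` such that
`R{x, y} = {x, y, w}` for some `x, y` outside the twin class of `w`. -/
def resolvingInvolutions (G : Type*) [Group G] : Set G :=
  {w : G | orderOf w = 2 ∧
    ∃ x y : G, x ∉ twinClass w ∧ y ∉ twinClass w ∧ resolvers x y = {x, y, w}}

/-- The class `Ψ` of noncyclic groups satisfying (C1)-(C4) for some odd prime `p`. -/
def IsPsi (G : Type*) [Group G] : Prop :=
  ¬ IsCyclic G ∧ ∃ p : ℕ, p.Prime ∧ Odd p ∧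
    (Nat.card G).primeFactors = {2, p} ∧
    (∃! H : Subgroup G, Nat.card H = p) ∧
    (¬ ∃ x : G, orderOf x = 4) ∧
    (∀ w : G, orderOf w = 2 → ∃ C : Subgroup G, IsCyclic C ∧ Nat.card C = 2 * p ∧ w ∈ C)

end PowerGraph

/-!
Distances in the power graph are at most two, so a set is resolving if and only if its complement
`T` contains no two elements `x ≠ y` whose separators (the elements of `R{x, y}` other than `x` and
`y`) all lie in `T`. In particular `T` is twin-free, so it misses some twin classes, and the metric
dimension is `|G| - |U(G)|` plus the least number of missed classes.

If `T` is twin-free and contains `x`, `y` and all their separators, then every separator is its own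
only twin; as `z` and `z⁻¹` are twins, every separator is an involution. When `x` and `y` are
nontrivial, this forces one of them to be a power of the other and the separator `w` to be unique:
`w` splits the pair. Hence `T` must miss one of the classes of `x`, `y` and `w`. Different resolving
involutions lead to disjoint triples of classes, so at least `|W(G)|` classes are missed, while it
is enough to miss the classes of the resolving involutions themselves.

The remaining case is `x = 1`, where the separators are the elements not comparable with `y`. If
all of them are involutions without further twins, then `y` is a core: it has odd prime order `p`,
every element of order greater than two has `y` as a power, and `y` commutes with all involutions.
A noncyclic group with a core and an involution lies in `Ψ`, and in a group of `Ψ` no involution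
splits a pair, so that missing the class of `1` is both necessary and sufficient.
-/

namespace PowerGraph

open Subgroup

section SimpleGraph

variable {V : Type*} {Γ : SimpleGraph V} {S : Set V} {t u x y z : V}

/-- The vertices other than `x` and `y` that are adjacent to exactly one of `x` and `y`. In a
graph of diameter at most two, these are the vertices of `R{x, y}` other than `x` and `y`; in any
graph, `x` and `y` are twins if and only if there are none. -/
def separators (Γ : SimpleGraph V) (x y : V) : Set V :=
  {z | z ≠ x ∧ z ≠ y ∧ ¬ (Γ.Adj x z ↔ Γ.Adj y z)}

/-- The vertices `w` that are their only twin, where `w` and `z` being twins is encoded as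
`separators Γ w z = ∅`. -/
def twinless (Γ : SimpleGraph V) : Set V :=
  {w | ∀ z, separators Γ w z = ∅ → z = w}

theorem separators_comm (Γ : SimpleGraph V) (x y : V) : separators Γ x y = separators Γ y x := by
  ext z
  simp only [separators, Set.mem_ofPred_eq]
  tauto

theorem separators_self (Γ : SimpleGraph V) (x : V) : separators Γ x x = ∅ :=
  Set.eq_empty_of_forall_notMem fun _ hz => hz.2.2 Iff.rfl

theorem adj_iff_of_separators_eq_empty (h : separators Γ x y = ∅) (hx : z ≠ x) (hy : z ≠ y) :
    Γ.Adj x z ↔ Γ.Adj y z := by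
  by_contra hz
  exact (Set.eq_empty_iff_forall_notMem.1 h) z ⟨hx, hy, hz⟩

theorem separators_eq_empty_iff : separators Γ x y = ∅ ↔ Γ.neighborSet x = Γ.neighborSet y ∨
    insert x (Γ.neighborSet x) = insert y (Γ.neighborSet y) := by
  simp only [Set.ext_iff, Set.mem_insert_iff, SimpleGraph.mem_neighborSet]
  constructor
  · intro h
    by_cases hxy : Γ.Adj x y
    · refine .inr fun z => ?_
      rcases eq_or_ne z x with rfl | hx
      · simp [hxy.symm]
      rcases eq_or_ne z y with rfl | hy
      · simp [hxy]
      simp [hx, hy, adj_iff_of_separators_eq_empty (Set.ext_iff.2 h) hx hy]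
    · refine .inl fun z => ?_
      rcases eq_or_ne z x with rfl | hx
      · simpa using mt SimpleGraph.Adj.symm hxy
      rcases eq_or_ne z y with rfl | hy
      · simp [hxy]
      exact adj_iff_of_separators_eq_empty (Set.ext_iff.2 h) hx hy
  · rintro (h | h) z
    · exact iff_of_false (fun hz => hz.2.2 (h z)) (Set.notMem_empty z)
    · refine iff_of_false (fun ⟨hx, hy, hz⟩ => hz ?_) (Set.notMem_empty z)
      simpa [hx, hy] using h z

theorem separators_eq_empty_trans (hxy : separators Γ x y = ∅) (hyz : separators Γ y z = ∅) :
    separators Γ x z = ∅ := by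
  rcases eq_or_ne x y with rfl | hne
  · exact hyz
  rcases eq_or_ne y z with rfl | hne'
  · exact hxy
  rcases eq_or_ne x z with rfl | hxz
  · exact separators_self Γ x
  refine Set.eq_empty_of_forall_notMem fun u ⟨hux, huz, hu⟩ => hu ?_
  rcases eq_or_ne u y with rfl | huy
  · rw [Γ.adj_comm x, adj_iff_of_separators_eq_empty hyz hne hxz, Γ.adj_comm z,
      adj_iff_of_separators_eq_empty hxy hxz.symm hne'.symm, Γ.adj_comm u]
  · rw [adj_iff_of_separators_eq_empty hxy hux huy, adj_iff_of_separators_eq_empty hyz huy huz]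

theorem mem_separators_of_twin (htwin : separators Γ z u = ∅) (hz : z ∈ separators Γ x y)
    (hux : u ≠ x) (huy : u ≠ y) : u ∈ separators Γ x y := by
  refine ⟨hux, huy, fun hu => hz.2.2 ?_⟩
  rwa [Γ.adj_comm x, Γ.adj_comm y, adj_iff_of_separators_eq_empty htwin hz.1.symm hux.symm,
    adj_iff_of_separators_eq_empty htwin hz.2.1.symm huy.symm, Γ.adj_comm u, Γ.adj_comm u]

theorem separators_subset_of_twin (htwin : separators Γ x t = ∅)
    (h : separators Γ x y ⊆ twinless Γ) : separators Γ t y ⊆ separators Γ x y := by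
  rintro s ⟨hst, hsy, hs⟩
  have hty : t ≠ y := by
    rintro rfl
    exact hs Iff.rfl
  have hsx : s ≠ x := by
    rintro rfl
    have ht : t ∈ separators Γ s y := by
      refine ⟨hst.symm, hty, fun hiff => hs ?_⟩
      rw [Γ.adj_comm, hiff, Γ.adj_comm, Γ.adj_comm y,
        adj_iff_of_separators_eq_empty htwin hsy.symm hty.symm]
    exact hst (h ht s ((separators_comm Γ t s).trans htwin))
  exact ⟨hsx, hsy, by rwa [adj_iff_of_separators_eq_empty htwin hsx hst]⟩

theorem dist_eq_dist_iff_adj_iff (hΓ : Γ.Connected) (hdist : ∀ a b, Γ.dist a b ≤ 2)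
    (hx : z ≠ x) (hy : z ≠ y) : Γ.dist x z = Γ.dist y z ↔ (Γ.Adj x z ↔ Γ.Adj y z) := by
  rw [← SimpleGraph.dist_eq_one_iff_adj, ← SimpleGraph.dist_eq_one_iff_adj]
  have := hΓ.pos_dist_of_ne hx.symm
  have := hΓ.pos_dist_of_ne hy.symm
  have := hdist x z
  have := hdist y z
  omega

theorem isResolvingSet_iff (hΓ : Γ.Connected) (hdist : ∀ a b, Γ.dist a b ≤ 2) :
    IsResolvingSet Γ S ↔ ∀ x ∉ S, ∀ y ∉ S, separators Γ x y ⊆ Sᶜ → x = y := by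
  constructor
  · refine fun h x hx y hy hsep => h x y fun s hs => ?_
    have hsx : s ≠ x := ne_of_mem_of_not_mem hs hx
    have hsy : s ≠ y := ne_of_mem_of_not_mem hs hy
    by_contra hne
    exact hsep ⟨hsx, hsy, (dist_eq_dist_iff_adj_iff hΓ hdist hsx hsy).not.1 hne⟩ hs
  · intro h x y hxy
    by_contra hne
    have hx : x ∉ S := fun hx =>
      hne (hΓ.dist_eq_zero_iff.1 ((hxy x hx).symm.trans SimpleGraph.dist_self)).symm
    have hy : y ∉ S := fun hy =>
      hne (hΓ.dist_eq_zero_iff.1 ((hxy y hy).trans SimpleGraph.dist_self))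
    refine hne (h x hx y hy fun s ⟨hsx, hsy, hs⟩ hsS => hs ?_)
    exact (dist_eq_dist_iff_adj_iff hΓ hdist hsx hsy).1 (hxy s hsS)

theorem IsResolvingSet.eq_of_twin (hS : IsResolvingSet Γ S) (hΓ : Γ.Connected)
    (hdist : ∀ a b, Γ.dist a b ≤ 2) (hx : x ∉ S) (hy : y ∉ S) (hxy : separators Γ x y = ∅) :
    x = y :=
  (isResolvingSet_iff hΓ hdist).1 hS x hx y hy (hxy ▸ Set.empty_subset _)

theorem IsResolvingSet.exists_forall_twin_mem (hS : IsResolvingSet Γ S) (hΓ : Γ.Connected)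
    (hdist : ∀ a b, Γ.dist a b ≤ 2) (hne : (separators Γ x y).Nonempty)
    (hsep : separators Γ x y ⊆ twinless Γ) :
    ∃ a ∈ insert x (insert y (separators Γ x y)), ∀ t, separators Γ a t = ∅ → t ∈ S := by
  by_contra! hmeet
  obtain ⟨t, hxt, ht⟩ := hmeet x (by simp)
  obtain ⟨u, hyu, hu⟩ := hmeet y (by simp)
  have hsub : separators Γ t y ⊆ separators Γ x y := separators_subset_of_twin hxt hsep
  have hsub' : separators Γ t u ⊆ separators Γ x y := by
    rw [separators_comm] at hsub ⊢
    exact (separators_subset_of_twin hyu (hsub.trans hsep)).trans hsub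
  have htu : t = u := by
    refine (isResolvingSet_iff hΓ hdist).1 hS t ht u hu fun s hs => ?_
    obtain ⟨r, hsr, hr⟩ := hmeet s (.inr (.inr (hsub' hs)))
    rwa [← hsep (hsub' hs) r hsr]
  rw [separators_eq_empty_trans hxt (htu ▸ separators_comm Γ u y ▸ hyu)] at hne
  exact Set.not_nonempty_empty hne

theorem separators_subset_twinless {T : Set V}
    (hT : ∀ a ∈ T, ∀ b ∈ T, separators Γ a b = ∅ → a = b) (hx : x ∈ T) (hy : y ∈ T)
    (hsub : separators Γ x y ⊆ T) : separators Γ x y ⊆ twinless Γ := by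
  intro z hz u hzu
  have huT : u ∈ T := by
    by_contra huT
    exact huT (hsub (mem_separators_of_twin hzu hz (ne_of_mem_of_not_mem hx huT).symm
      (ne_of_mem_of_not_mem hy huT).symm))
  exact (hT z (hsub hz) u huT hzu).symm

theorem metricDim_add_ncard_eq [Finite V] {T : Set V} (hT : IsResolvingSet Γ Tᶜ)
    (hmax : ∀ S, IsResolvingSet Γ S → Sᶜ.ncard ≤ T.ncard) :
    metricDim Γ + T.ncard = Nat.card V := by
  have hle : metricDim Γ ≤ Tᶜ.ncard := Nat.sInf_le ⟨_, hT, rfl⟩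
  have hT_card := Set.ncard_add_ncard_compl T
  have hge : Tᶜ.ncard ≤ metricDim Γ := by
    refine le_csInf ⟨_, _, hT, rfl⟩ ?_
    rintro _ ⟨S, hS, rfl⟩
    have hS_card := Set.ncard_add_ncard_compl S
    have := hmax S hS
    omega
  omega

end SimpleGraph

section Cyclic

variable {G : Type*} [Group G] {a b g u w x : G}

theorem eq_one_or_eq_of_mem_zpowers (hw : orderOf w = 2) (hx : x ∈ zpowers w) :
    x = 1 ∨ x = w := by
  classical
  have hfin : IsOfFinOrder w := orderOf_pos_iff.1 (by omega)
  rw [hfin.mem_zpowers_iff_mem_range_orderOf, hw] at hx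
  simpa [Finset.range_add_one, eq_comm, or_comm] using hx

theorem ne_one_of_orderOf_eq_two (hw : orderOf w = 2) : w ≠ 1 := by
  rintro rfl
  simp at hw

theorem inv_ne_self (hx : x ≠ 1) (hx2 : orderOf x ≠ 2) : x⁻¹ ≠ x := fun hinv =>
  hx2 (orderOf_eq_prime (by rw [pow_two, mul_eq_one_iff_eq_inv, hinv]) hx)

theorem commute_of_mem_zpowers (ha : a ∈ zpowers g) (hb : b ∈ zpowers g) : Commute a b := by
  obtain ⟨i, rfl⟩ := mem_zpowers_iff.1 ha
  obtain ⟨j, rfl⟩ := mem_zpowers_iff.1 hb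
  exact Commute.zpow_zpow_self g i j

variable [Finite G]

theorem mem_zpowers_of_orderOf_dvd (ha : a ∈ zpowers g) (hb : b ∈ zpowers g)
    (h : orderOf a ∣ orderOf b) : a ∈ zpowers b := by
  lift a to zpowers g using ha
  lift b to zpowers g using hb
  rw [orderOf_coe, orderOf_coe] at h
  let _ : CommGroup (zpowers g) := IsCyclic.commGroup
  have htorsion : zpowers b = (powMonoidHom (orderOf b) : zpowers g →* zpowers g).ker := by
    refine eq_of_le_of_card_ge ?_ ?_
    · simp [MonoidHom.mem_ker, pow_orderOf_eq_one]
    · rw [IsCyclic.card_powMonoidHom_ker, Nat.card_zpowers b]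
      exact Nat.gcd_le_right _ (orderOf_pos b)
  have hab : a ∈ zpowers b := by
    rw [htorsion, MonoidHom.mem_ker, powMonoidHom_apply]
    exact orderOf_dvd_iff_pow_eq_one.1 h
  obtain ⟨k, hk⟩ := mem_zpowers_iff.1 hab
  exact mem_zpowers_iff.2 ⟨k, by rw [← hk, coe_zpow]⟩

theorem eq_of_mem_zpowers_of_orderOf_eq_two (hu : orderOf u = 2) (hw : orderOf w = 2)
    (hug : u ∈ zpowers g) (hwg : w ∈ zpowers g) : u = w :=
  have huw : u ∈ zpowers w := mem_zpowers_of_orderOf_dvd hug hwg (by rw [hu, hw])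
  (eq_one_or_eq_of_mem_zpowers hw huw).resolve_left (ne_one_of_orderOf_eq_two hu)

theorem exists_mem_zpowers_orderOf_eq {n : ℕ} (h : n ∣ orderOf x) :
    ∃ w ∈ zpowers x, orderOf w = n :=
  ⟨_, pow_mem (mem_zpowers x) _, orderOf_pow_orderOf_div (orderOf_pos x).ne' h⟩

end Cyclic

section Comparable

variable {G : Type*} [Group G] {a b w x y z : G}

/-- Two elements of a group are comparable if one of them lies in the cyclic subgroup generated by
the other. In a finite group, this is adjacency in the power graph or equality. -/
def Comparable (x y : G) : Prop :=
  x ∈ zpowers y ∨ y ∈ zpowers x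

theorem Comparable.symm (h : Comparable x y) : Comparable y x :=
  Or.symm h

theorem comparable_comm : Comparable x y ↔ Comparable y x :=
  ⟨.symm, .symm⟩

theorem comparable_refl (x : G) : Comparable x x :=
  .inl (mem_zpowers x)

theorem comparable_one_left (x : G) : Comparable 1 x :=
  .inl (one_mem _)

theorem ne_one_of_not_comparable (h : ¬ Comparable x y) : x ≠ 1 := by
  rintro rfl
  exact h (comparable_one_left y)

theorem comparable_inv_left : Comparable x⁻¹ y ↔ Comparable x y := by
  simp only [Comparable, inv_mem_iff, zpowers_inv]

theorem mem_zpowers_of_comparable (hw : orderOf w = 2) (hx : x ≠ 1) (h : Comparable x w) :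
    w ∈ zpowers x := by
  rcases h with hxw | hwx
  · obtain rfl := (eq_one_or_eq_of_mem_zpowers hw hxw).resolve_left hx
    exact hxw
  · exact hwx

theorem not_comparable_of_odd (hx : x ≠ 1) (hodd : Odd (orderOf x)) (hw : orderOf w = 2) :
    ¬ Comparable x w := fun h => by
  have hdvd := orderOf_dvd_of_mem_zpowers (mem_zpowers_of_comparable hw hx h)
  rw [hw] at hdvd
  exact Nat.not_even_iff_odd.2 hodd (even_iff_two_dvd.2 hdvd)

theorem powerGraph_dist_le_two (x y : G) : (powerGraph G).dist x y ≤ 2 := by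
  have hone (z : G) : (powerGraph G).dist z 1 ≤ 1 := by
    rcases eq_or_ne z 1 with rfl | hz
    · simp
    · exact (SimpleGraph.dist_eq_one_iff_adj.2 (show (powerGraph G).Adj z 1 from
        ⟨hz, .inl ⟨0, (pow_zero z).symm⟩⟩)).le
  calc (powerGraph G).dist x y
      ≤ (powerGraph G).dist x 1 + (powerGraph G).dist 1 y := (powerGraph_connected G).dist_triangle
    _ ≤ 2 := by
      rw [SimpleGraph.dist_comm (u := 1)]
      exact add_le_add (hone x) (hone y)

theorem twin_iff_separators_eq_empty : Twin x y ↔ separators (powerGraph G) x y = ∅ :=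
  separators_eq_empty_iff.symm

theorem Twin.refl (x : G) : Twin x x :=
  .inl rfl

theorem Twin.symm (h : Twin x y) : Twin y x :=
  h.imp Eq.symm Eq.symm

theorem Twin.trans (hxy : Twin x y) (hyz : Twin y z) : Twin x z := by
  rw [twin_iff_separators_eq_empty] at *
  exact separators_eq_empty_trans hxy hyz

theorem twinClass_eq_iff : twinClass x = twinClass y ↔ Twin x y := by
  refine ⟨fun h => ?_, fun h => Set.ext fun z => ⟨h.symm.trans, h.trans⟩⟩
  have hy : y ∈ twinClass y := Twin.refl y
  rwa [← h] at hy

theorem Twin.eq_of_mem_twinless (h : Twin w z) (hw : w ∈ twinless (powerGraph G)) : z = w :=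
  hw z (twin_iff_separators_eq_empty.1 h)

theorem mem_resolvers_iff (hxz : z ≠ x) (hyz : z ≠ y) :
    z ∈ resolvers x y ↔ z ∈ separators (powerGraph G) x y := by
  have hiff := dist_eq_dist_iff_adj_iff (powerGraph_connected G) powerGraph_dist_le_two hxz hyz
  exact ⟨fun hz => ⟨hxz, hyz, hiff.not.1 hz⟩, fun hz => hiff.not.2 hz.2.2⟩

theorem resolvers_eq_insert (hxy : x ≠ y) :
    resolvers x y = insert x (insert y (separators (powerGraph G) x y)) := by
  have hpos := (powerGraph_connected G).pos_dist_of_ne hxy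
  ext z
  rw [Set.mem_insert_iff, Set.mem_insert_iff]
  rcases eq_or_ne z x with rfl | hxz
  · simpa [resolvers, SimpleGraph.dist_comm] using hpos.ne
  rcases eq_or_ne z y with rfl | hyz
  · simpa [resolvers] using hpos.ne'
  simp only [mem_resolvers_iff hxz hyz, hxz, hyz, false_or]

theorem mem_resolvingInvolutions_iff : w ∈ resolvingInvolutions G ↔
    orderOf w = 2 ∧ w ∈ twinless (powerGraph G) ∧
      ∃ x y, separators (powerGraph G) x y = {w} := by
  refine and_congr_right fun _ => ⟨?_, ?_⟩
  · rintro ⟨x, y, hx, hy, hR⟩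
    have hwx : w ≠ x := fun h => hx (h ▸ Twin.refl w)
    have hwy : w ≠ y := fun h => hy (h ▸ Twin.refl w)
    have hsep (z : G) (hzx : z ≠ x) (hzy : z ≠ y) :
        z ∈ separators (powerGraph G) x y ↔ z = w := by
      rw [← mem_resolvers_iff hzx hzy, hR]
      simp [hzx, hzy]
    refine ⟨fun z hz => ?_, x, y, ?_⟩
    · have hzx : z ≠ x := by
        rintro rfl
        exact hx (twin_iff_separators_eq_empty.2 hz)
      have hzy : z ≠ y := by
        rintro rfl
        exact hy (twin_iff_separators_eq_empty.2 hz)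
      exact (hsep z hzx hzy).1
        (mem_separators_of_twin hz ((hsep w hwx hwy).2 rfl) hzx hzy)
    · ext z
      exact ⟨fun hz => (hsep z hz.1 hz.2.1).1 hz, fun hz => by
        obtain rfl : z = w := hz
        exact (hsep z hwx hwy).2 rfl⟩
  · rintro ⟨htwin, x, y, hsep⟩
    have hw : w ∈ separators (powerGraph G) x y := hsep ▸ rfl
    have hxy : x ≠ y := by
      rintro rfl
      exact hw.2.2 Iff.rfl
    exact ⟨x, y, fun h => hw.1 (Twin.eq_of_mem_twinless h htwin).symm,
      fun h => hw.2.1 (Twin.eq_of_mem_twinless h htwin).symm, by rw [resolvers_eq_insert hxy, hsep]⟩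

variable [Finite G]

theorem powerGraph_adj_iff : (powerGraph G).Adj x y ↔ x ≠ y ∧ Comparable x y := by
  simp only [powerGraph, Comparable, ← mem_powers_iff_mem_zpowers, Submonoid.mem_powers_iff,
    eq_comm (b := x ^ _), eq_comm (b := y ^ _), or_comm]

theorem mem_separators_iff : z ∈ separators (powerGraph G) x y ↔
    z ≠ x ∧ z ≠ y ∧ ¬ (Comparable x z ↔ Comparable y z) := by
  refine and_congr_right fun hx => and_congr_right fun hy => ?_
  rw [powerGraph_adj_iff, powerGraph_adj_iff, and_iff_right hx.symm, and_iff_right hy.symm]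

theorem mem_separators_one_iff :
    z ∈ separators (powerGraph G) 1 y ↔ ¬ Comparable y z := by
  simp only [mem_separators_iff, comparable_one_left, true_iff]
  refine ⟨fun h => h.2.2, fun h => ⟨?_, ?_, h⟩⟩ <;> rintro rfl
  · exact h (comparable_one_left y).symm
  · exact h (comparable_refl z)

theorem one_notMem_separators : (1 : G) ∉ separators (powerGraph G) x y := fun h =>
  (mem_separators_iff.1 h).2.2
    (iff_of_true (comparable_one_left x).symm (comparable_one_left y).symm)

theorem Twin.comparable_iff (h : Twin a b) (ha : z ≠ a) (hb : z ≠ b) :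
    Comparable a z ↔ Comparable b z := by
  by_contra hz
  exact Set.eq_empty_iff_forall_notMem.1 (twin_iff_separators_eq_empty.1 h) z
    (mem_separators_iff.2 ⟨ha, hb, hz⟩)

theorem twin_inv (x : G) : Twin x x⁻¹ :=
  twin_iff_separators_eq_empty.2 <| Set.eq_empty_of_forall_notMem fun _ hz =>
    (mem_separators_iff.1 hz).2.2 comparable_inv_left.symm

theorem Twin.comparable (h : Twin a b) (ha : orderOf a ≠ 2) : Comparable a b := by
  rcases eq_or_ne a 1 with rfl | ha1
  · exact comparable_one_left b
  rcases eq_or_ne a⁻¹ b with rfl | hb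
  · exact (comparable_inv_left.2 (comparable_refl a)).symm
  have haa : Comparable a a⁻¹ := (comparable_inv_left.2 (comparable_refl a)).symm
  have hba : Comparable b a⁻¹ := (h.comparable_iff (inv_ne_self ha1 ha) hb).1 haa
  exact comparable_inv_left.1 hba.symm

theorem Twin.comparable_iff_of_orderOf_ne_two (h : Twin a b) (hx : orderOf x ≠ 2) :
    Comparable a x ↔ Comparable b x := by
  rcases eq_or_ne x a with rfl | ha
  · exact iff_of_true (comparable_refl x) (h.comparable hx).symm
  rcases eq_or_ne x b with rfl | hb
  · exact iff_of_true (h.symm.comparable hx).symm (comparable_refl x)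
  exact h.comparable_iff ha hb

theorem orderOf_eq_two_of_mem_twinless (hz : z ∈ twinless (powerGraph G)) (hz1 : z ≠ 1) :
    orderOf z = 2 := by
  by_contra hz2
  exact inv_ne_self hz1 hz2 ((twin_inv z).eq_of_mem_twinless hz)

theorem orderOf_eq_two_of_mem_separators
    (hsep : separators (powerGraph G) x y ⊆ twinless (powerGraph G))
    (hz : z ∈ separators (powerGraph G) x y) : orderOf z = 2 :=
  orderOf_eq_two_of_mem_twinless (hsep hz) (ne_of_mem_of_not_mem hz one_notMem_separators)

end Comparable

section Split

variable {G : Type*} [Group G] [Finite G] {a a' u w w' x x' y y' z : G}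

/-- The involution `w` splits the pair `(x, y)` if `y ≠ 1` is a power of `x` and `w` is the only
element that separates `x` from `y`. This is the typical way in which a resolving involution
arises. -/
structure IsSplitBy (x y w : G) : Prop where
  orderOf_eq : orderOf w = 2
  ne_one : y ≠ 1
  mem : y ∈ zpowers x
  separators_eq : separators (powerGraph G) x y = {w}

namespace IsSplitBy

theorem comparable_iff (h : IsSplitBy x y w) (hz : z ≠ w) : Comparable x z ↔ Comparable y z := by
  by_contra hsep
  have hzx : z ≠ x := by
    rintro rfl
    exact hsep (iff_of_true (comparable_refl z) (.inl h.mem))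
  have hzy : z ≠ y := by
    rintro rfl
    exact hsep (iff_of_true (.inr h.mem) (comparable_refl z))
  exact hz (h.separators_eq ▸ mem_separators_iff.2 ⟨hzx, hzy, hsep⟩ : z ∈ ({w} : Set G))

theorem notMem_right (h : IsSplitBy x y w) : w ∉ zpowers y := fun hw => by
  have hmem : w ∈ separators (powerGraph G) x y := h.separators_eq ▸ rfl
  exact (mem_separators_iff.1 hmem).2.2 (iff_of_true (.inr (zpowers_le.2 h.mem hw)) (.inr hw))

theorem mem_left (h : IsSplitBy x y w) : w ∈ zpowers x := by
  have hmem : w ∈ separators (powerGraph G) x y := h.separators_eq ▸ rfl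
  have hx : x ≠ 1 := by
    rintro rfl
    exact h.ne_one (by simpa using h.mem)
  have hy : ¬ Comparable y w := fun hyw =>
    h.notMem_right (mem_zpowers_of_comparable h.orderOf_eq h.ne_one hyw)
  refine mem_zpowers_of_comparable h.orderOf_eq hx ?_
  by_contra hxw
  exact (mem_separators_iff.1 hmem).2.2 (iff_of_false hxw hy)

theorem odd_orderOf (h : IsSplitBy x y w) : Odd (orderOf y) := by
  rw [← Nat.not_even_iff_odd, even_iff_two_dvd]
  intro hdvd
  obtain ⟨u, huy, hu⟩ := exists_mem_zpowers_orderOf_eq hdvd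
  obtain rfl : u = w :=
    eq_of_mem_zpowers_of_orderOf_eq_two hu h.orderOf_eq (zpowers_le.2 h.mem huy) h.mem_left
  exact h.notMem_right huy

theorem orderOf_left_ne_two (h : IsSplitBy x y w) : orderOf x ≠ 2 := fun hx => by
  obtain rfl := (eq_one_or_eq_of_mem_zpowers hx h.mem).resolve_left h.ne_one
  exact h.notMem_right h.mem_left

theorem comparable_of_mem (h : IsSplitBy x y w) (hy : y ∈ zpowers z) : Comparable x z := by
  rcases eq_or_ne z w with rfl | hz
  · exact .inr h.mem_left
  · exact (h.comparable_iff hz).2 (.inl hy)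

theorem eq_of_mem (h : IsSplitBy x y w) (ha : a ∈ ({x, y, w} : Set G)) (hu : orderOf u = 2)
    (haz : a ∈ zpowers z) (huz : u ∈ zpowers z) : u = w := by
  have of_comparable (hxz : Comparable x z) : u = w := by
    rcases hxz with hxz | hzx
    · exact eq_of_mem_zpowers_of_orderOf_eq_two hu h.orderOf_eq huz (zpowers_le.2 hxz h.mem_left)
    · exact eq_of_mem_zpowers_of_orderOf_eq_two hu h.orderOf_eq (zpowers_le.2 hzx huz) h.mem_left
  rcases ha with rfl | rfl | rfl
  · exact of_comparable (.inl haz)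
  · exact of_comparable (h.comparable_of_mem haz)
  · exact eq_of_mem_zpowers_of_orderOf_eq_two hu h.orderOf_eq huz haz

theorem mem_of_mem (h : IsSplitBy x y w) (ha : a ∈ ({x, y, w} : Set G)) : a ∈ zpowers x := by
  rcases ha with rfl | rfl | rfl
  · exact mem_zpowers a
  · exact h.mem
  · exact h.mem_left

theorem eq_of_twin (h : IsSplitBy x y w) (h' : IsSplitBy x' y' w')
    (ha : a ∈ ({x, y, w} : Set G)) (ha' : a' ∈ ({x', y', w'} : Set G)) (htwin : Twin a a') :
    w = w' := by
  have hax' : Comparable a x' :=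
    (htwin.comparable_iff_of_orderOf_ne_two h'.orderOf_left_ne_two).2 (.inl (h'.mem_of_mem ha'))
  obtain ⟨z, haz, hx'z⟩ : ∃ z, a ∈ zpowers z ∧ x' ∈ zpowers z :=
    hax'.elim (fun hax' => ⟨x', hax', mem_zpowers x'⟩) fun hx'a => ⟨a, mem_zpowers a, hx'a⟩
  exact (h.eq_of_mem ha h'.orderOf_eq haz (zpowers_le.2 hx'z h'.mem_left)).symm

end IsSplitBy

theorem isSplitBy_of_mem_zpowers (hy : y ≠ 1)
    (hsep : ∀ z ∈ separators (powerGraph G) x y, orderOf z = 2)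
    (hw : w ∈ separators (powerGraph G) x y) (hwx : w ∈ zpowers x) : IsSplitBy x y w := by
  have hw2 : orderOf w = 2 := hsep w hw
  have hwy : ¬ Comparable y w := fun hyw =>
    (mem_separators_iff.1 hw).2.2 (iff_of_true (.inr hwx) hyw)
  have hx2 : orderOf x ≠ 2 := fun hx =>
    (eq_one_or_eq_of_mem_zpowers hx hwx).elim (ne_one_of_orderOf_eq_two hw2) hw.1
  have hx1 : x ≠ 1 := by
    rintro rfl
    exact ne_one_of_orderOf_eq_two hw2 (by simpa using hwx)
  have hcomp : Comparable x⁻¹ y := by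
    rcases eq_or_ne x⁻¹ y with hxy | hxy
    · exact hxy ▸ comparable_refl _
    by_contra hnot
    have hinv : x⁻¹ ∈ separators (powerGraph G) x y := mem_separators_iff.2
      ⟨inv_ne_self hx1 hx2, hxy, fun hiff =>
        hnot (hiff.1 (comparable_inv_left.2 (comparable_refl x)).symm).symm⟩
    exact hx2 (by rw [← orderOf_inv, hsep _ hinv])
  have hyx : y ∈ zpowers x := (comparable_inv_left.1 hcomp).resolve_left fun hxy =>
    hwy (.inr (zpowers_le.2 hxy hwx))
  refine ⟨hw2, hy, hyx, Set.eq_singleton_iff_unique_mem.2 ⟨hw, fun z hz => ?_⟩⟩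
  have hz2 : orderOf z = 2 := hsep z hz
  have hzx : z ∈ zpowers x := by
    by_contra hzx
    refine (mem_separators_iff.1 hz).2.2 (iff_of_false (fun hxz => ?_) fun hyz => ?_)
    · exact hzx (mem_zpowers_of_comparable hz2 hx1 hxz)
    · exact hzx (zpowers_le.2 hyx (mem_zpowers_of_comparable hz2 hy hyz))
  exact eq_of_mem_zpowers_of_orderOf_eq_two hz2 hw2 hzx hwx

theorem isSplitBy_or_isSplitBy (hx : x ≠ 1) (hy : y ≠ 1)
    (hsep : ∀ z ∈ separators (powerGraph G) x y, orderOf z = 2)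
    (hw : w ∈ separators (powerGraph G) x y) : IsSplitBy x y w ∨ IsSplitBy y x w := by
  by_cases hxw : Comparable x w
  · exact .inl (isSplitBy_of_mem_zpowers hy hsep hw
      (mem_zpowers_of_comparable (hsep w hw) hx hxw))
  · have hyw : Comparable y w := by
      by_contra hyw
      exact (mem_separators_iff.1 hw).2.2 (iff_of_false hxw hyw)
    rw [separators_comm] at hsep hw
    exact .inr (isSplitBy_of_mem_zpowers hx hsep hw
      (mem_zpowers_of_comparable (hsep w hw) hy hyw))

end Split

section Core

variable {G : Type*} [Group G] {g v w x y z : G}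

/-- An element `y` of odd prime order is a core of `G` if it commutes with all involutions and every
element of order greater than two has `y` as a power. The groups in `Ψ` are the noncyclic groups
of even order that have a core. -/
structure IsCore (y : G) : Prop where
  prime : (orderOf y).Prime
  odd : Odd (orderOf y)
  mem_of_orderOf_ne_two : ∀ z : G, z ≠ 1 → orderOf z ≠ 2 → y ∈ zpowers z
  commute : ∀ w : G, orderOf w = 2 → Commute w y

namespace IsCore

theorem ne_one (hy : IsCore y) : y ≠ 1 :=
  orderOf_eq_one_iff.not.1 hy.prime.ne_one

theorem orderOf_ne_two (hy : IsCore y) : orderOf y ≠ 2 := fun h => by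
  simpa [h, Nat.odd_iff] using hy.odd

theorem orderOf_mul (hy : IsCore y) (hw : orderOf w = 2) : orderOf (w * y) = 2 * orderOf y := by
  have hcoprime : (orderOf w).Coprime (orderOf y) := by
    rw [hw, Nat.coprime_two_left]
    exact hy.odd
  rw [(hy.commute w hw).orderOf_mul_eq_mul_orderOf_of_coprime hcoprime, hw]

theorem orderOf_mul_ne_two (hy : IsCore y) (hw : orderOf w = 2) : orderOf (w * y) ≠ 2 := by
  have := hy.prime.two_le
  rw [hy.orderOf_mul hw]
  omega

theorem right_mem_zpowers_mul (hy : IsCore y) (hw : orderOf w = 2) : y ∈ zpowers (w * y) := by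
  refine hy.mem_of_orderOf_ne_two _ (orderOf_eq_one_iff.not.1 ?_) (hy.orderOf_mul_ne_two hw)
  rw [hy.orderOf_mul hw]
  omega

theorem left_mem_zpowers_mul (hy : IsCore y) (hw : orderOf w = 2) : w ∈ zpowers (w * y) := by
  simpa using mul_mem (mem_zpowers (w * y)) (inv_mem (hy.right_mem_zpowers_mul hw))

theorem orderOf_ne_four (hy : IsCore y) : orderOf x ≠ 4 := fun hx => by
  have hx1 : x ≠ 1 := orderOf_eq_one_iff.not.1 (by omega)
  have hdvd : orderOf y ∣ 2 ^ 2 := by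
    simpa [hx] using orderOf_dvd_of_mem_zpowers (hy.mem_of_orderOf_ne_two x hx1 (by omega))
  exact hy.orderOf_ne_two
    ((Nat.prime_dvd_prime_iff_eq hy.prime Nat.prime_two).1 (hy.prime.dvd_of_dvd_pow hdvd))

theorem not_comparable_iff (hy : IsCore y) : ¬ Comparable y z ↔ orderOf z = 2 := by
  refine ⟨fun hyz => ?_, fun hz => not_comparable_of_odd hy.ne_one hy.odd hz⟩
  by_contra hz2
  have hz1 : z ≠ 1 := by
    rintro rfl
    exact hyz (comparable_one_left y).symm
  exact hyz (.inl (hy.mem_of_orderOf_ne_two z hz1 hz2))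

variable [Finite G]

theorem separators_one_eq (hy : IsCore y) : separators (powerGraph G) 1 y = {z | orderOf z = 2} :=
  Set.ext fun _ => mem_separators_one_iff.trans hy.not_comparable_iff

theorem separators_one_subset_twinless (hy : IsCore y) :
    separators (powerGraph G) 1 y ⊆ twinless (powerGraph G) := by
  intro z hz u hzu
  have htwin : Twin z u := twin_iff_separators_eq_empty.2 hzu
  have hz2 : orderOf z = 2 := hy.not_comparable_iff.1 (mem_separators_one_iff.1 hz)
  have hyu : ¬ Comparable y u := by
    rw [comparable_comm, ← htwin.comparable_iff_of_orderOf_ne_two hy.orderOf_ne_two,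
      comparable_comm]
    exact mem_separators_one_iff.1 hz
  have hu2 : orderOf u = 2 := hy.not_comparable_iff.1 hyu
  have hu : Comparable u (z * y) :=
    (htwin.comparable_iff_of_orderOf_ne_two (hy.orderOf_mul_ne_two hz2)).1
      (.inl (hy.left_mem_zpowers_mul hz2))
  have hzy : z * y ≠ 1 := fun h => hy.ne_one (by simpa [h] using hy.right_mem_zpowers_mul hz2)
  exact eq_of_mem_zpowers_of_orderOf_eq_two hu2 hz2
    (mem_zpowers_of_comparable hu2 hzy hu.symm) (hy.left_mem_zpowers_mul hz2)

end IsCore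

variable [Finite G]

theorem exists_mem_zpowers_of_mem_twinless (hv : orderOf v = 2) (hw : orderOf w = 2)
    (hwv : w ≠ v) (htwin : v ∈ twinless (powerGraph G)) :
    ∃ g, orderOf g ≠ 2 ∧ (v ∈ zpowers g ∨ w ∈ zpowers g) := by
  obtain ⟨g, hg⟩ : (separators (powerGraph G) v w).Nonempty :=
    Set.nonempty_iff_ne_empty.2 fun hempty => hwv (htwin w hempty)
  have hg1 : g ≠ 1 := ne_of_mem_of_not_mem hg one_notMem_separators
  have ne_two (u : G) (hu : orderOf u = 2) (hgu : g ≠ u) (hug : u ∈ zpowers g) : orderOf g ≠ 2 :=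
    fun hg2 => hgu (eq_of_mem_zpowers_of_orderOf_eq_two hg2 hu (mem_zpowers g) hug)
  by_cases hvg : Comparable v g
  · have hvg := mem_zpowers_of_comparable hv hg1 hvg.symm
    exact ⟨g, ne_two v hv hg.1 hvg, .inl hvg⟩
  · have hwg : Comparable w g := by
      by_contra hwg
      exact (mem_separators_iff.1 hg).2.2 (iff_of_false hvg hwg)
    have hwg := mem_zpowers_of_comparable hw hg1 hwg.symm
    exact ⟨g, ne_two w hw hg.2.1 hwg, .inr hwg⟩

section SeparatorsOne

variable (hsep : separators (powerGraph G) 1 y ⊆ twinless (powerGraph G))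
include hsep

theorem orderOf_eq_two_of_not_comparable (hz : ¬ Comparable y z) : orderOf z = 2 :=
  orderOf_eq_two_of_mem_separators hsep (mem_separators_one_iff.2 hz)

theorem mem_zpowers_of_not_comparable (hv : ¬ Comparable y v) (hvg : v ∈ zpowers g)
    (hg : orderOf g ≠ 2) : y ∈ zpowers g := by
  have hyg : Comparable y g := by
    by_contra hyg
    exact hg (orderOf_eq_two_of_not_comparable hsep hyg)
  exact hyg.resolve_right fun hgy => hv (.inr (zpowers_le.2 hgy hvg))

theorem exists_mem_zpowers_of_not_comparable (hw : ¬ Comparable y w) :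
    ∃ g, y ∈ zpowers g ∧ w ∈ zpowers g := by
  by_cases hwy : Comparable y (w * y)
  · have hmem : y ∈ zpowers (w * y) := hwy.resolve_right fun h =>
      hw (.inr (by simpa using mul_mem h (inv_mem (mem_zpowers y))))
    exact ⟨w * y, hmem, by simpa using mul_mem (mem_zpowers (w * y)) (inv_mem hmem)⟩
  · obtain ⟨g, hg, hwg | hwyg⟩ := exists_mem_zpowers_of_mem_twinless
      (orderOf_eq_two_of_not_comparable hsep hw) (orderOf_eq_two_of_not_comparable hsep hwy)
      (by simpa using ne_one_of_not_comparable hw) (hsep (mem_separators_one_iff.2 hw))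
    · exact ⟨g, mem_zpowers_of_not_comparable hsep hw hwg hg, hwg⟩
    · have hyg : y ∈ zpowers g := mem_zpowers_of_not_comparable hsep hwy hwyg hg
      exact ⟨g, hyg, by simpa using mul_mem hwyg (inv_mem hyg)⟩

theorem odd_orderOf_of_not_comparable (hw : ¬ Comparable y w) : Odd (orderOf y) := by
  rw [← Nat.not_even_iff_odd, even_iff_two_dvd]
  intro hdvd
  obtain ⟨u, huy, hu⟩ := exists_mem_zpowers_orderOf_eq hdvd
  obtain ⟨g, hyg, hwg⟩ := exists_mem_zpowers_of_not_comparable hsep hw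
  obtain rfl : u = w := eq_of_mem_zpowers_of_orderOf_eq_two hu
    (orderOf_eq_two_of_not_comparable hsep hw) (zpowers_le.2 hyg huy) hwg
  exact hw (.inr huy)

theorem prime_orderOf_of_not_comparable (hw : ¬ Comparable y w) : (orderOf y).Prime := by
  have hw2 : orderOf w = 2 := orderOf_eq_two_of_not_comparable hsep hw
  have hy1 : y ≠ 1 := ne_one_of_not_comparable hw
  have hodd : Odd (orderOf y) := odd_orderOf_of_not_comparable hsep hw
  obtain ⟨p, hp, hpy⟩ := Nat.exists_prime_and_dvd (orderOf_eq_one_iff.not.2 hy1)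
  have hp_odd : Odd p := hodd.of_dvd_nat hpy
  obtain ⟨x, hxy, rfl⟩ := exists_mem_zpowers_orderOf_eq hpy
  obtain ⟨g, hyg, hwg⟩ := exists_mem_zpowers_of_not_comparable hsep hw
  have hwx : orderOf (w * x) = 2 * orderOf x := by
    have hcoprime : (orderOf w).Coprime (orderOf x) := by rwa [hw2, Nat.coprime_two_left]
    rw [(commute_of_mem_zpowers hwg (zpowers_le.2 hyg hxy)).orderOf_mul_eq_mul_orderOf_of_coprime
      hcoprime, hw2]
  have hcomp : Comparable y (w * x) := by
    by_contra hnot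
    have := orderOf_eq_two_of_not_comparable hsep hnot
    have := hp.two_le
    omega
  have hdvd : orderOf y ∣ 2 * orderOf x := by
    rw [← hwx]
    refine orderOf_dvd_of_mem_zpowers (hcomp.resolve_right fun h => hw (.inr ?_))
    simpa using mul_mem h (inv_mem hxy)
  rwa [(hodd.coprime_two_right.dvd_of_dvd_mul_left hdvd).antisymm hpy]

theorem isCore_of_not_comparable (hw : ¬ Comparable y w) : IsCore y := by
  have hprime : (orderOf y).Prime := prime_orderOf_of_not_comparable hsep hw
  have hodd : Odd (orderOf y) := odd_orderOf_of_not_comparable hsep hw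
  have hy1 : y ≠ 1 := ne_one_of_not_comparable hw
  refine ⟨hprime, hodd, fun z hz1 hz2 => ?_, fun u hu => ?_⟩
  · have hyz : Comparable y z := by
      by_contra hyz
      exact hz2 (orderOf_eq_two_of_not_comparable hsep hyz)
    refine hyz.elim id fun hzy => mem_zpowers_of_orderOf_dvd (mem_zpowers y) hzy ?_
    have hdvd := (Nat.dvd_prime hprime).1 (orderOf_dvd_of_mem_zpowers hzy)
    exact (hdvd.resolve_left (orderOf_eq_one_iff.not.2 hz1)).symm.dvd
  · obtain ⟨g, hyg, hug⟩ :=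
      exists_mem_zpowers_of_not_comparable hsep (not_comparable_of_odd hy1 hodd hu)
    exact commute_of_mem_zpowers hug hyg

end SeparatorsOne

section Psi

theorem IsCore.eq_two_or_eq_of_prime (hy : IsCore y) {q : ℕ} (hq : q.Prime)
    (hqG : q ∣ Nat.card G) : q = 2 ∨ q = orderOf y := by
  have := Fact.mk hq
  obtain ⟨x, rfl⟩ := exists_prime_orderOf_dvd_card' q hqG
  refine or_iff_not_imp_left.2 fun hx2 => ?_
  have hyx : y ∈ zpowers x :=
    hy.mem_of_orderOf_ne_two x (orderOf_eq_one_iff.not.1 hq.ne_one) hx2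
  exact ((Nat.prime_dvd_prime_iff_eq hy.prime hq).1 (orderOf_dvd_of_mem_zpowers hyx)).symm

theorem IsCore.eq_zpowers (hy : IsCore y) {K : Subgroup G} (hK : Nat.card K = orderOf y) :
    K = zpowers y := by
  have := Fact.mk hy.prime
  obtain ⟨k, hk⟩ := exists_prime_orderOf_dvd_card' (G := K) (orderOf y) hK.symm.dvd
  rw [← orderOf_coe] at hk
  have hyk : y ∈ zpowers (k : G) := hy.mem_of_orderOf_ne_two _
    (orderOf_eq_one_iff.not.1 (hk ▸ hy.prime.ne_one)) (hk ▸ hy.orderOf_ne_two)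
  refine (eq_of_le_of_card_ge (zpowers_le.2 (zpowers_le.2 k.2 hyk)) ?_).symm
  rw [hK, Nat.card_zpowers]

theorem IsCore.isPsi (hy : IsCore y) (hcyc : ¬ IsCyclic G) (hw : orderOf w = 2) : IsPsi G := by
  refine ⟨hcyc, orderOf y, hy.prime, hy.odd, ?_,
    ⟨zpowers y, Nat.card_zpowers y, fun K hK => hy.eq_zpowers hK⟩,
    fun ⟨x, hx⟩ => hy.orderOf_ne_four hx, fun u hu => ⟨zpowers (u * y), inferInstance,
      (Nat.card_zpowers _).trans (hy.orderOf_mul hu), hy.left_mem_zpowers_mul hu⟩⟩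
  ext q
  rw [Nat.mem_primeFactors_of_ne_zero Nat.card_pos.ne', Finset.mem_insert, Finset.mem_singleton]
  constructor
  · exact fun ⟨hq, hqG⟩ => hy.eq_two_or_eq_of_prime hq hqG
  · rintro (rfl | rfl)
    · exact ⟨Nat.prime_two, hw ▸ orderOf_dvd_natCard w⟩
    · exact ⟨hy.prime, orderOf_dvd_natCard y⟩

theorem IsPsi.exists_orderOf_eq_two (h : IsPsi G) : ∃ w : G, orderOf w = 2 := by
  obtain ⟨-, p, -, -, hfactors, -⟩ := h
  have := Fact.mk Nat.prime_two
  refine exists_prime_orderOf_dvd_card' 2 (Nat.dvd_of_mem_primeFactors ?_)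
  simp [hfactors]

theorem exists_orderOf_eq_four (hz1 : z ≠ 1) (hz2 : orderOf z ≠ 2)
    (hz : ∀ q : ℕ, q.Prime → q ∣ orderOf z → q = 2) : ∃ x : G, orderOf x = 4 := by
  obtain ⟨k, hk⟩ : ∃ k, orderOf z = 2 ^ k :=
    ⟨_, Nat.eq_prime_pow_of_unique_prime_dvd (orderOf_pos z).ne' fun {q} => hz q⟩
  have hk_two : 2 ≤ k := by
    by_contra! hk_lt
    interval_cases k
    · exact hz1 (orderOf_eq_one_iff.1 hk)
    · exact hz2 hk
  obtain ⟨x, -, hx⟩ := exists_mem_zpowers_orderOf_eq (hk ▸ pow_dvd_pow 2 hk_two)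
  exact ⟨x, hx⟩

theorem IsPsi.exists_isCore (h : IsPsi G) : ∃ y : G, IsCore y := by
  obtain ⟨-, p, hp, hodd, hfactors, ⟨H, hH, hH_unique⟩, hfour, hinv⟩ := h
  have := Fact.mk hp
  obtain ⟨y, rfl⟩ : ∃ y, zpowers y = H :=
    (Subgroup.isCyclic_iff_exists_zpowers_eq_top H).1 (isCyclic_of_prime_card hH)
  rw [Nat.card_zpowers] at hH
  have mem_of_dvd (z : G) (hz : p ∣ orderOf z) : y ∈ zpowers z := by
    obtain ⟨x, hxz, hx⟩ := exists_mem_zpowers_orderOf_eq hz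
    have hxy : zpowers x = zpowers y := hH_unique _ ((Nat.card_zpowers x).trans hx)
    exact zpowers_le.2 hxz (hxy ▸ mem_zpowers y)
  refine ⟨y, hH ▸ hp, hH ▸ hodd, fun z hz1 hz2 => ?_, fun w hw => ?_⟩
  · by_contra hyz
    have hpz : ¬ p ∣ orderOf z := fun hpz => hyz (mem_of_dvd z hpz)
    refine hfour (exists_orderOf_eq_four hz1 hz2 fun q hq hqz => ?_)
    have hqG : q ∈ (Nat.card G).primeFactors :=
      Nat.mem_primeFactors.2 ⟨hq, hqz.trans (orderOf_dvd_natCard z), Nat.card_pos.ne'⟩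
    rw [hfactors, Finset.mem_insert, Finset.mem_singleton] at hqG
    exact hqG.resolve_right fun hqp => hpz (hqp ▸ hqz)
  · obtain ⟨C, hC, hC_card, hwC⟩ := hinv w hw
    obtain ⟨g, rfl⟩ := (Subgroup.isCyclic_iff_exists_zpowers_eq_top C).1 hC
    rw [Nat.card_zpowers] at hC_card
    exact commute_of_mem_zpowers hwC (mem_of_dvd g (hC_card ▸ dvd_mul_left p 2))

theorem isCyclic_of_forall_comparable (hfour : ∀ z : G, orderOf z ≠ 4) (hx : 2 ∣ orderOf x)
    (hcomp : ∀ z, Comparable x z) : IsCyclic G := by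
  refine ⟨x, fun z => ?_⟩
  refine (hcomp z).elim (fun hxz => ?_) id
  obtain ⟨m, hm⟩ : 2 ∣ orderOf z := hx.trans (orderOf_dvd_of_mem_zpowers hxz)
  have hm_odd : ¬ 2 ∣ m := fun ⟨k, hk⟩ => by
    obtain ⟨u, -, hu⟩ := exists_mem_zpowers_orderOf_eq (show 4 ∣ orderOf z from ⟨k, by omega⟩)
    exact hfour u hu
  have hz_sq : orderOf (z ^ 2) = m := by
    rw [orderOf_pow_of_dvd two_ne_zero (hm ▸ dvd_mul_right 2 m), hm,
      Nat.mul_div_cancel_left m two_pos]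
  have hmx : m ∣ orderOf x := by
    rw [← hz_sq] at hm_odd ⊢
    exact orderOf_dvd_of_mem_zpowers ((hcomp (z ^ 2)).resolve_left fun hxz_sq =>
      hm_odd (hx.trans (orderOf_dvd_of_mem_zpowers hxz_sq)))
  refine mem_zpowers_of_orderOf_dvd (mem_zpowers z) hxz ?_
  rw [hm]
  exact (Nat.prime_two.coprime_iff_not_dvd.2 hm_odd).mul_dvd_of_dvd_of_dvd hx hmx

theorem IsPsi.not_isSplitBy (h : IsPsi G) : ¬ IsSplitBy x y w := by
  intro hsplit
  obtain ⟨v, hv⟩ := h.exists_isCore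
  have hw2 : orderOf w = 2 := hsplit.orderOf_eq
  have hvy : v ∈ zpowers y := hv.mem_of_orderOf_ne_two y hsplit.ne_one fun hy => by
    simpa [hy, Nat.odd_iff] using hsplit.odd_orderOf
  have hne : w * v ≠ w := by simpa using hv.ne_one
  have hy_comp : Comparable y (w * v) := (hsplit.comparable_iff hne).1
    (.inr (mul_mem hsplit.mem_left (zpowers_le.2 hsplit.mem hvy)))
  have hy_wv : y ∈ zpowers (w * v) := hy_comp.resolve_right fun hmem =>
    hsplit.notMem_right (by simpa using mul_mem hmem (inv_mem hvy))
  have hdvd : orderOf y ∣ orderOf v := by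
    refine (Nat.coprime_two_right.2 hsplit.odd_orderOf).dvd_of_dvd_mul_left ?_
    rw [← hv.orderOf_mul hw2]
    exact orderOf_dvd_of_mem_zpowers hy_wv
  have hyv : y ∈ zpowers v :=
    mem_zpowers_of_orderOf_dvd hy_wv (hv.right_mem_zpowers_mul hw2) hdvd
  refine h.1 (isCyclic_of_forall_comparable (x := x) (fun _ => hv.orderOf_ne_four)
    (hw2 ▸ orderOf_dvd_of_mem_zpowers hsplit.mem_left) fun z => ?_)
  by_cases hz2 : orderOf z = 2
  · obtain rfl : z = w := hsplit.eq_of_mem (by simp) hz2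
      (zpowers_le.2 (hv.right_mem_zpowers_mul hz2) hyv) (hv.left_mem_zpowers_mul hz2)
    exact .inr hsplit.mem_left
  rcases eq_or_ne z 1 with rfl | hz1
  · exact (comparable_one_left x).symm
  · exact hsplit.comparable_of_mem (zpowers_le.2 (hv.mem_of_orderOf_ne_two z hz1 hz2) hyv)

theorem separators_one_subsingleton (h : ¬ IsPsi G)
    (hsep : separators (powerGraph G) 1 y ⊆ twinless (powerGraph G)) :
    (separators (powerGraph G) 1 y).Subsingleton := by
  intro u hu w hw
  have hu2 : orderOf u = 2 := orderOf_eq_two_of_mem_separators hsep hu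
  have hw2 : orderOf w = 2 := orderOf_eq_two_of_mem_separators hsep hw
  have hcyc : IsCyclic G := by
    by_contra hcyc
    exact h ((isCore_of_not_comparable hsep (mem_separators_one_iff.1 hw)).isPsi hcyc hw2)
  obtain ⟨g, hg⟩ := hcyc
  exact eq_of_mem_zpowers_of_orderOf_eq_two hu2 hw2 (hg u) (hg w)

end Psi

end Core

section MetricDimension

variable {G : Type*} [Group G] {S T : Set G} {w x y : G}

theorem IsResolvingSet.injOn_twinClass_compl (hS : IsResolvingSet (powerGraph G) S) :
    Set.InjOn twinClass Sᶜ := fun _ hx _ hy hxy =>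
  hS.eq_of_twin (powerGraph_connected G) powerGraph_dist_le_two hx hy
    (twin_iff_separators_eq_empty.1 (twinClass_eq_iff.1 hxy))

variable (G) in
theorem exists_transversal : ∃ T : Set G, Set.InjOn twinClass T ∧
    T.ncard = (twinClasses G).ncard ∧ ∀ x, ∃ t ∈ T, Twin x t := by
  obtain ⟨T, -, hT⟩ := Set.exists_subset_bijOn Set.univ (twinClass : G → Set G)
  have himage : twinClass '' T = twinClasses G := by
    rw [hT.image_eq, Set.image_univ]
    ext C
    simp only [Set.mem_range, twinClasses, Set.mem_ofPred_eq, eq_comm]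
  refine ⟨T, hT.injOn, by rw [← himage, hT.injOn.ncard_image], fun x => ?_⟩
  obtain ⟨t, ht, htx⟩ : twinClass x ∈ twinClass '' T := himage ▸ ⟨x, rfl⟩
  exact ⟨t, ht, twinClass_eq_iff.1 htx.symm⟩

theorem isResolvingSet_compl (hT : Set.InjOn twinClass T)
    (h : ∀ x ∈ T, ∀ y ∈ T, separators (powerGraph G) x y ⊆ twinless (powerGraph G) →
      separators (powerGraph G) x y ⊆ T → separators (powerGraph G) x y = ∅) :
    IsResolvingSet (powerGraph G) Tᶜ := by
  rw [isResolvingSet_iff (powerGraph_connected G) powerGraph_dist_le_two]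
  simp only [Set.notMem_compl_iff, compl_compl]
  intro x hx y hy hxy
  have eq_of_twin (a : G) (ha : a ∈ T) (b : G) (hb : b ∈ T)
      (hab : separators (powerGraph G) a b = ∅) : a = b :=
    hT ha hb (twinClass_eq_iff.2 (twin_iff_separators_eq_empty.2 hab))
  exact eq_of_twin x hx y hy (h x hx y hy (separators_subset_twinless eq_of_twin hx hy hxy) hxy)

theorem IsResolvingSet.exists_twinClass_subset (hS : IsResolvingSet (powerGraph G) S)
    (hne : (separators (powerGraph G) x y).Nonempty)
    (hsep : separators (powerGraph G) x y ⊆ twinless (powerGraph G)) :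
    ∃ a ∈ insert x (insert y (separators (powerGraph G) x y)), twinClass a ⊆ S := by
  obtain ⟨a, ha, haS⟩ :=
    hS.exists_forall_twin_mem (powerGraph_connected G) powerGraph_dist_le_two hne hsep
  exact ⟨a, ha, fun t hat => haS t (twin_iff_separators_eq_empty.1 hat)⟩

variable [Finite G]

theorem IsResolvingSet.ncard_compl_add_ncard_le (hS : IsResolvingSet (powerGraph G) S)
    {ι : Type*} {I : Set ι} {f : ι → G} (hf : Set.InjOn (fun i => twinClass (f i)) I)
    (hfS : ∀ i ∈ I, twinClass (f i) ⊆ S) : Sᶜ.ncard + I.ncard ≤ (twinClasses G).ncard := by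
  have hdisj : Disjoint (twinClass '' Sᶜ) ((fun i => twinClass (f i)) '' I) := by
    rw [Set.disjoint_left]
    rintro _ ⟨x, hx, rfl⟩ ⟨i, hi, hix⟩
    exact hx (hfS i hi (twinClass_eq_iff.1 hix))
  rw [← hS.injOn_twinClass_compl.ncard_image, ← hf.ncard_image, ← Set.ncard_union_eq hdisj]
  refine Set.ncard_le_ncard ?_
  rintro _ (⟨x, -, rfl⟩ | ⟨i, -, rfl⟩)
  exacts [⟨x, rfl⟩, ⟨f i, rfl⟩]

theorem exists_separators_eq_of_mem_resolvingInvolutions (hw : w ∈ resolvingInvolutions G) :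
    ∃ x y : G, separators (powerGraph G) x y = {w} ∧
      ((resolvingInvolutions G).Subsingleton ∨ IsSplitBy x y w) := by
  obtain ⟨hw2, htwinless, x, y, hxy⟩ := mem_resolvingInvolutions_iff.1 hw
  have subsingleton_of_one (z : G) (hz : separators (powerGraph G) 1 z = {w}) :
      (resolvingInvolutions G).Subsingleton := by
    have hz_core : IsCore z := isCore_of_not_comparable (by simpa [hz] using htwinless)
      (mem_separators_one_iff.1 (hz ▸ rfl : w ∈ _))
    refine (Set.subsingleton_singleton (a := w)).anti fun u hu => ?_
    rw [← hz, hz_core.separators_one_eq]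
    exact hu.1
  rcases eq_or_ne x 1 with rfl | hx
  · exact ⟨1, y, hxy, .inl (subsingleton_of_one y hxy)⟩
  rcases eq_or_ne y 1 with rfl | hy
  · exact ⟨x, 1, hxy, .inl (subsingleton_of_one x (separators_comm _ 1 x ▸ hxy))⟩
  rcases isSplitBy_or_isSplitBy hx hy (by simpa [hxy] using hw2) (hxy ▸ rfl : w ∈ _) with h | h
  · exact ⟨x, y, hxy, .inr h⟩
  · exact ⟨y, x, h.separators_eq, .inr h⟩

theorem IsResolvingSet.exists_twinClass_subset_of_mem (hS : IsResolvingSet (powerGraph G) S)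
    (hw : w ∈ resolvingInvolutions G) : ∃ a, twinClass a ⊆ S ∧
      ((resolvingInvolutions G).Subsingleton ∨
        ∃ x y, IsSplitBy x y w ∧ a ∈ ({x, y, w} : Set G)) := by
  obtain ⟨x, y, hxy, hsplit⟩ := exists_separators_eq_of_mem_resolvingInvolutions hw
  have hsep : separators (powerGraph G) x y ⊆ twinless (powerGraph G) := by
    simpa [hxy] using (mem_resolvingInvolutions_iff.1 hw).2.1
  obtain ⟨a, ha, haS⟩ := hS.exists_twinClass_subset (hxy ▸ Set.singleton_nonempty w) hsep
  exact ⟨a, haS, hsplit.imp_right fun h => ⟨x, y, h, hxy ▸ ha⟩⟩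

theorem IsResolvingSet.ncard_compl_add_ncard_resolvingInvolutions_le
    (hS : IsResolvingSet (powerGraph G) S) :
    Sᶜ.ncard + (resolvingInvolutions G).ncard ≤ (twinClasses G).ncard := by
  choose! f hfS hf using fun w hw => hS.exists_twinClass_subset_of_mem (w := w) hw
  refine hS.ncard_compl_add_ncard_le (f := f) (fun w hw w' hw' htwin => ?_) hfS
  rcases hf w hw with hsub | ⟨x, y, hsplit, ha⟩
  · exact hsub hw hw'
  rcases hf w' hw' with hsub | ⟨x', y', hsplit', ha'⟩
  · exact hsub hw hw'
  exact hsplit.eq_of_twin hsplit' ha ha' (twinClass_eq_iff.1 htwin)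

theorem IsResolvingSet.ncard_compl_lt_of_isPsi (hS : IsResolvingSet (powerGraph G) S)
    (h : IsPsi G) : Sᶜ.ncard < (twinClasses G).ncard := by
  obtain ⟨y, hy⟩ := h.exists_isCore
  obtain ⟨w, hw⟩ := h.exists_orderOf_eq_two
  have hw_sep : w ∈ separators (powerGraph G) 1 y := hy.separators_one_eq ▸ hw
  obtain ⟨a, -, ha⟩ := hS.exists_twinClass_subset ⟨w, hw_sep⟩ hy.separators_one_subset_twinless
  simpa using hS.ncard_compl_add_ncard_le (f := id) (Set.injOn_singleton _ a) (by simpa using ha)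

theorem separators_subset_resolvingInvolutions (h : ¬ IsPsi G)
    (hsep : separators (powerGraph G) x y ⊆ twinless (powerGraph G)) :
    separators (powerGraph G) x y ⊆ resolvingInvolutions G := by
  intro w hw
  have horder (z : G) (hz : z ∈ separators (powerGraph G) x y) : orderOf z = 2 :=
    orderOf_eq_two_of_mem_separators hsep hz
  refine mem_resolvingInvolutions_iff.2 ⟨horder w hw, hsep hw, ?_⟩
  rcases eq_or_ne x 1 with rfl | hx
  · exact ⟨1, y, (separators_one_subsingleton h hsep).eq_singleton_of_mem hw⟩
  rcases eq_or_ne y 1 with rfl | hy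
  · rw [separators_comm] at hsep hw
    exact ⟨1, x, (separators_one_subsingleton h hsep).eq_singleton_of_mem hw⟩
  rcases isSplitBy_or_isSplitBy hx hy horder hw with hsplit | hsplit
  exacts [⟨x, y, hsplit.separators_eq⟩, ⟨y, x, hsplit.separators_eq⟩]

theorem metricDim_of_isPsi (h : IsPsi G) :
    metricDim (powerGraph G) + (twinClasses G).ncard = Nat.card G + 1 := by
  obtain ⟨T, hT, hT_card, hT_meets⟩ := exists_transversal G
  obtain ⟨e, he, htwin⟩ := hT_meets 1
  have ne_one (x : G) (hx : x ∈ T \ {e}) : x ≠ 1 := by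
    rintro rfl
    exact hx.2 (hT hx.1 he (twinClass_eq_iff.2 htwin))
  have hres : IsResolvingSet (powerGraph G) (T \ {e})ᶜ := by
    refine isResolvingSet_compl (hT.mono Set.sdiff_subset) fun x hx y hy hsep _ => ?_
    refine Set.eq_empty_of_forall_notMem fun w hw => ?_
    exact (isSplitBy_or_isSplitBy (ne_one x hx) (ne_one y hy)
      (fun _ => orderOf_eq_two_of_mem_separators hsep) hw).elim h.not_isSplitBy h.not_isSplitBy
  have hcard := Set.ncard_sdiff_singleton_add_one he
  have := metricDim_add_ncard_eq hres fun S hS => by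
    have := hS.ncard_compl_lt_of_isPsi h
    omega
  omega

theorem metricDim_of_not_isPsi (h : ¬ IsPsi G) :
    metricDim (powerGraph G) + (twinClasses G).ncard =
      Nat.card G + (resolvingInvolutions G).ncard := by
  obtain ⟨T, hT, hT_card, hT_meets⟩ := exists_transversal G
  have hsub : resolvingInvolutions G ⊆ T := by
    intro w hw
    obtain ⟨t, ht, hwt⟩ := hT_meets w
    rwa [hwt.eq_of_mem_twinless (mem_resolvingInvolutions_iff.1 hw).2.1] at ht
  have hres : IsResolvingSet (powerGraph G) (T \ resolvingInvolutions G)ᶜ := by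
    refine isResolvingSet_compl (hT.mono Set.sdiff_subset) fun x _ y _ hsep hsubT => ?_
    refine Set.eq_empty_of_forall_notMem fun w hw => ?_
    exact (hsubT hw).2 (separators_subset_resolvingInvolutions h hsep hw)
  have hcard := Set.ncard_sdiff_add_ncard_of_subset hsub
  have := metricDim_add_ncard_eq hres fun S hS => by
    have := hS.ncard_compl_add_ncard_resolvingInvolutions_le
    omega
  omega

end MetricDimension

end PowerGraph

theorem mainTheorem1 (G : Type*) [Group G] [Finite G] :
    (PowerGraph.IsPsi G →
      (PowerGraph.metricDim (PowerGraph.powerGraph G) : ℤ) =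
        (Nat.card G : ℤ) - ((PowerGraph.twinClasses G).ncard : ℤ) + 1) ∧
    (¬ PowerGraph.IsPsi G →
      (PowerGraph.metricDim (PowerGraph.powerGraph G) : ℤ) =
        (Nat.card G : ℤ) - ((PowerGraph.twinClasses G).ncard : ℤ)
          + ((PowerGraph.resolvingInvolutions G).ncard : ℤ)) := by
  constructor <;> intro h
  · have := PowerGraph.metricDim_of_isPsi h
    omega
  · have := PowerGraph.metricDim_of_not_isPsi h
    omega
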